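/- For every integer $r\ge 2$ there is exactly one sequence of numbers $(c_k^{(r)})_{k\ge0}$, independent of $n$, such that $$\sum_{k=0}^n\binom nk^r\binom{n+k}k^r=\sum_{k=0}^n\binom nk\binom{n+k}k\,c_k^{(r)}\qquad\text{for all } n=0,1,2,\dots .$$ All the numbers $c_k^{(r)}$ ($r\ge2$, $k\ge0$) are integers. Moreover, with the convention that binomial coefficients with a negative lower entry are $0$ (so that all sums below are finite), for every $n=0,1,2,\dots$ $$c_n^{(4)}=\sum_j\binom{2j}j^3\binom nj\sum_k\binom{k+j}{k-j}\binom j{n-k}\binom kj\binom{2j}{k-j},$$ $$c_n^{(5)}=\sum_j\binom{2j}j^4\binom nj^2\sum_k\binom{k+j}{k-j}^2\binom{2j}{n-k}\binom{2j}{k-j},$$ and in general, for every $s\ge2$, $$c_n^{(2s)}=\sum_j\binom{2j}j^{2s-1}\binom nj\sum_{k_1}\binom j{n-k_1}\binom{k_1}j\binom{k_1+j}{k_1-j}\sum_{k_2}\binom{2j}{k_1-k_2}\binom{k_2+j}{k_2-j}^2\cdots\sum_{k_{s-1}}\binom{2j}{k_{s-2}-k_{s-1}}\binom{k_{s-1}+j}{k_{s-1}-j}^2\binom{2j}{k_{s-1}-j}$$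 (for $s=2$ there is only the sum over $k_1$, followed by the last factor $\binom{2j}{k_1-j}$), while for $s=1$ $$c_n^{(2)}=\sum_j\binom nj^2\binom{2j}n;$$ and for every $s\ge1$, with $k_0=n$, $$c_n^{(2s+1)}=\sum_j\binom{2j}j^{2s}\binom nj^2\sum_{k_1}\binom{2j}{n-k_1}\binom{k_1+j}{k_1-j}^2\sum_{k_2}\binom{2j}{k_1-k_2}\binom{k_2+j}{k_2-j}^2\cdots\sum_{k_{s-1}}\binom{2j}{k_{s-2}-k_{s-1}}\binom{k_{s-1}+j}{k_{s-1}-j}^2\binom{2j}{k_{s-1}-j}$$ (for $s=1$ there are no inner sums and only the last factor $\binom{2j}{n-j}$ remains). -/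

import Mathlib

/-- `c` is a sequence of numbers, independent of `n`, whose Legendre transform is
`n ↦ ∑ₖ C(n,k)^r C(n+k,k)^r`. -/
def IsSchmidtSequence (r : ℕ) (c : ℕ → ℝ) : Prop :=
  ∀ n : ℕ,
    ∑ k ∈ Finset.range (n + 1), (n.choose k : ℝ) ^ r * ((n + k).choose k : ℝ) ^ r =
      ∑ k ∈ Finset.range (n + 1), (n.choose k : ℝ) * ((n + k).choose k : ℝ) * c k

/-- The nested sum of `m` levels, starting from `k₀ = k`:
`∑_{k₁} C(2j,k₀-k₁) C(k₁+j,k₁-j)² ⋯ ∑_{kₘ} C(2j,kₘ₋₁-kₘ) C(kₘ+j,kₘ-j)² · C(2j,kₘ-j)`.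
The factors `C(2j,kᵢ₋₁-kᵢ)` and `C(kᵢ+j,kᵢ-j)` vanish unless `j ≤ kᵢ ≤ kᵢ₋₁`, which is the range
used here; with `j ≤ k` no subtraction below is truncated. -/
def nestedSum (j : ℕ) : ℕ → ℕ → ℕ
  | 0, k => (2 * j).choose (k - j)
  | m + 1, k => ∑ l ∈ Finset.Icc j k,
      (2 * j).choose (k - l) * (l + j).choose (l - j) ^ 2 * nestedSum j m l

/-! Write `P n` for `legendreKernel N n`, a polynomial of degree `n` in `x = N(N+1)`. A product of
three kernels expands in the `P n` with explicit coefficients independent of `N`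
(`legendreKernel_mul_mul`). Repeatedly multiplying by `P j ^ 2` therefore expands every odd power of
`P j`, each multiplication adding one level to `nestedSum`; one more factor `P j` gives the even
powers. Summing over `j` and exchanging sums yields `c n` as a natural number. Uniqueness holds
because the defining system is triangular. -/

/-- The Legendre kernel `C(N,n) C(N+n,n)`. -/
noncomputable def legendreKernel (N n : ℕ) : ℝ := (N.choose n : ℝ) * ((N + n).choose n : ℝ)

/-! ### Binomial recurrences and the recurrence of the kernel. -/

lemma cast_choose_succ_mul (n k : ℕ) :
    (n.choose (k + 1) : ℝ) * (k + 1) = n.choose k * ((n : ℝ) - k) := by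
  rcases le_or_gt k n with h | h
  · rw [← Nat.cast_sub h]
    exact_mod_cast Nat.choose_succ_right_eq n k
  · simp [Nat.choose_eq_zero_of_lt h, Nat.choose_eq_zero_of_lt (h.trans (Nat.lt_succ_self k))]

lemma cast_succ_mul_choose (n k : ℕ) :
    ((n : ℝ) + 1) * n.choose k = (n + 1).choose (k + 1) * ((k : ℝ) + 1) := by
  exact_mod_cast Nat.add_one_mul_choose_eq n k

lemma cast_succ_mul_choose_same (n k : ℕ) :
    ((n : ℝ) + 1) * n.choose k = (n + 1).choose k * ((n : ℝ) + 1 - k) := by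
  have h := cast_choose_succ_mul (n + 1) k
  push_cast at h
  rw [← h, cast_succ_mul_choose]

lemma legendreKernel_zero (N : ℕ) : legendreKernel N 0 = 1 := by simp [legendreKernel]

lemma legendreKernel_eq_zero {N n : ℕ} (h : N < n) : legendreKernel N n = 0 := by
  simp [legendreKernel, Nat.choose_eq_zero_of_lt h]

lemma legendreKernel_succ (N n : ℕ) :
    ((n : ℝ) + 1) ^ 2 * legendreKernel N (n + 1) =
      ((N : ℝ) * (N + 1) - n * (n + 1)) * legendreKernel N n := by
  have h1 := cast_choose_succ_mul N n
  have h2 := cast_succ_mul_choose (N + n) n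
  push_cast at h2
  have h3 : N + (n + 1) = N + n + 1 := by ring
  simp only [legendreKernel, h3]
  linear_combination (((N + n + 1).choose (n + 1) : ℝ) * (n + 1)) * h1 -
    ((N.choose n : ℝ) * (N - n)) * h2

/-! ### Linearization of products of kernels. -/

/-- Multiplication by `x` acts bidiagonally on the `g n`, so coefficients are compared after an
index shift; `a M = 0` removes the boundary term. -/
lemma mul_sum_range_of_two_term {R : Type*} [CommRing R] (x : R) (g a d p w : ℕ → R) (M : ℕ)
    (hg : ∀ n, x * g n = p n * g n + w n * g (n + 1)) (ha : a M = 0)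
    (h0 : d 0 = a 0 * p 0) (hd : ∀ n, d (n + 1) = a (n + 1) * p (n + 1) + a n * w n) :
    x * ∑ n ∈ Finset.range M, a n * g n = ∑ n ∈ Finset.range (M + 1), d n * g n := by
  have h1 : ∑ n ∈ Finset.range M, a n * p n * g n =
      ∑ n ∈ Finset.range M, a (n + 1) * p (n + 1) * g (n + 1) + a 0 * p 0 * g 0 := by
    rw [← Finset.sum_range_succ' (fun n => a n * p n * g n), Finset.sum_range_succ, ha]
    ring
  rw [Finset.sum_range_succ', h0]
  simp only [hd, add_mul, Finset.sum_add_distrib]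
  rw [add_right_comm, ← h1, ← Finset.sum_add_distrib, Finset.mul_sum]
  refine Finset.sum_congr rfl fun n _ => ?_
  linear_combination a n * hg n

/-- The coefficient of `legendreKernel N (l + m)` in the product of three kernels, up to a factor
independent of `m`. -/
noncomputable def tripleCoeff (i j l m : ℕ) : ℝ :=
  ((l + m).choose i : ℝ) * (l + m).choose j * (i + j).choose m

/-- This is the induction step in `j`: by `legendreKernel_succ`, the factor on the left turns `P j`
into a multiple of `P (j + 1)`. -/
lemma mul_sum_tripleCoeff (N i j l : ℕ) :
    ((N : ℝ) * (N + 1) - j * (j + 1)) *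
        ∑ m ∈ Finset.range (i + j + 1), tripleCoeff i j l m * legendreKernel N (l + m) =
      ∑ m ∈ Finset.range (i + (j + 1) + 1),
        (((l : ℝ) + j + 1) * (j + 1) * tripleCoeff i (j + 1) l m) *
          legendreKernel N (l + m) := by
  refine mul_sum_range_of_two_term _ (fun m => legendreKernel N (l + m)) _ _
    (fun m => ((l : ℝ) + m) * (l + m + 1) - j * (j + 1)) (fun m => ((l : ℝ) + m + 1) ^ 2) _
    ?_ ?_ ?_ ?_
  · intro m
    have h := legendreKernel_succ N (l + m)
    push_cast at h
    rw [← add_assoc, h]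
    ring
  · simp [tripleCoeff]
  · have h := cast_choose_succ_mul l j
    simp only [tripleCoeff, add_zero, Nat.choose_zero_right, Nat.cast_one, Nat.cast_zero]
    linear_combination (((l : ℝ) + j + 1) * l.choose i) * h
  · intro m
    have h1 := cast_choose_succ_mul (l + m + 1) j
    have h2 := cast_succ_mul_choose (l + m) j
    have h3 := cast_succ_mul_choose_same (l + m) i
    have h4 := cast_choose_succ_mul (i + j) m
    have h5 : (((i + j + 1).choose (m + 1) : ℕ) : ℝ) =
        (i + j).choose m + (i + j).choose (m + 1) := by
      exact_mod_cast Nat.choose_succ_succ (i + j) m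
    push_cast at h1 h2 h3 h4
    simp only [tripleCoeff, ← add_assoc, h5]
    push_cast
    linear_combination
      (((l + m + 1).choose i : ℝ) * (i + j).choose (m + 1) * (l + m + 1 + j + 1)) * h1
      - (((l : ℝ) + m + 1) * (l + m).choose i * (i + j).choose m) * h2
      - (((l + m + 1).choose (j + 1) : ℝ) * (j + 1) * (i + j).choose m) * h3
      - (((l + m + 1).choose i : ℝ) * (l + m + 1).choose (j + 1) * (j + 1)) * h4

lemma legendreKernel_mul_mul_of_zero (N i l : ℕ)
    (h : legendreKernel N i * legendreKernel N l = ((l + i).choose i : ℝ) *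
      ∑ m ∈ Finset.range (i + 1), tripleCoeff i 0 l m * legendreKernel N (l + m)) (j : ℕ) :
    legendreKernel N i * legendreKernel N j * legendreKernel N l =
      ((l + i).choose i : ℝ) * (l + j).choose j *
        ∑ m ∈ Finset.range (i + j + 1), tripleCoeff i j l m * legendreKernel N (l + m) := by
  induction j with
  | zero => simpa [legendreKernel_zero] using h
  | succ j ih =>
    have hj : ((j : ℝ) + 1) ^ 2 ≠ 0 := by positivity
    apply mul_left_cancel₀ hj
    have h1 := legendreKernel_succ N j
    have h2 := mul_sum_tripleCoeff N i j l
    have h3 := cast_succ_mul_choose (l + j) j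
    simp only [mul_assoc (((l : ℝ) + j + 1) * (j + 1)), ← Finset.mul_sum] at h2
    push_cast at h3
    rw [← add_assoc l j 1]
    linear_combination (legendreKernel N i * legendreKernel N l) * h1 +
      ((N : ℝ) * (N + 1) - j * (j + 1)) * ih +
      (((l + i).choose i : ℝ) * (l + j).choose j) * h2 +
      (((l + i).choose i : ℝ) * (j + 1) * ∑ m ∈ Finset.range (i + (j + 1) + 1),
        tripleCoeff i (j + 1) l m * legendreKernel N (l + m)) * h3

lemma legendreKernel_mul_mul_range (N i j l : ℕ) :
    legendreKernel N i * legendreKernel N j * legendreKernel N l =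
      ((l + i).choose i : ℝ) * (l + j).choose j *
        ∑ m ∈ Finset.range (i + j + 1), tripleCoeff i j l m * legendreKernel N (l + m) := by
  refine legendreKernel_mul_mul_of_zero N i l ?_ j
  -- The product of two kernels is the same induction run with first index `0`, where the base case
  -- is trivial.
  have h := legendreKernel_mul_mul_of_zero N 0 l (by simp [tripleCoeff, legendreKernel_zero]) i
  simpa [tripleCoeff, legendreKernel_zero] using h

/-- Linearization of a product of three Legendre kernels. -/
lemma legendreKernel_mul_mul (N i j l : ℕ) :
    legendreKernel N i * legendreKernel N j * legendreKernel N l =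
      ∑ n ∈ Finset.Ico l (N + 1), (((l + i).choose i * (l + j).choose j * n.choose i *
        n.choose j * (i + j).choose (n - l) : ℕ) : ℝ) * legendreKernel N n := by
  rw [legendreKernel_mul_mul_range, Finset.sum_Ico_eq_sum_range, Finset.mul_sum]
  -- Both ranges are extended to a common one: beyond `i + j` the binomial coefficient vanishes, and
  -- beyond `N - l` the kernel does.
  have h1 := Finset.sum_subset (Finset.range_mono (Nat.le_add_right (i + j + 1) (N + 1 - l)))
    (f := fun m => ((l + i).choose i : ℝ) * (l + j).choose j *
      (tripleCoeff i j l m * legendreKernel N (l + m))) (by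
      intro m _ hm
      simp only [Finset.mem_range, not_lt] at hm
      simp [tripleCoeff, Nat.choose_eq_zero_of_lt (show i + j < m by omega)])
  have h2 := Finset.sum_subset (Finset.range_mono (Nat.le_add_left (N + 1 - l) (i + j + 1)))
    (f := fun m => ((l + i).choose i : ℝ) * (l + j).choose j *
      (tripleCoeff i j l m * legendreKernel N (l + m))) (by
      intro m _ hm
      simp only [Finset.mem_range, not_lt] at hm
      simp [legendreKernel_eq_zero (show N < l + m by omega)])
  rw [h1, ← h2]
  refine Finset.sum_congr rfl fun m _ => ?_
  simp only [tripleCoeff, Nat.add_sub_cancel_left]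
  push_cast
  ring

/-! ### Expansion of the powers of one kernel. -/

lemma choose_mul_choose_add {j k : ℕ} (h : j ≤ k) :
    (2 * j).choose j * (k + j).choose (k - j) = k.choose j * (k + j).choose j := by
  have h1 := Nat.choose_mul (n := k + j) (k := 2 * j) (s := j) (by omega)
  rw [show k + j - j = k by omega, show 2 * j - j = j by omega] at h1
  rw [show k - j = k + j - 2 * j by omega, Nat.choose_symm (by omega), mul_comm, h1, mul_comm]

/-- The coefficients of the odd powers `legendreKernel N j ^ (2 * t + 3)`. -/
def oddCoeff (t j n : ℕ) : ℕ := (2 * j).choose j ^ (2 * t + 2) * n.choose j ^ 2 * nestedSum j t n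

/-- The coefficients of the even powers `legendreKernel N j ^ (2 * t + 4)`. -/
def evenCoeff (t j n : ℕ) : ℕ :=
  (2 * j).choose j ^ (2 * t + 3) * n.choose j *
    ∑ k ∈ Finset.Icc j n, j.choose (n - k) * k.choose j * (k + j).choose (k - j) * nestedSum j t k

lemma oddCoeff_eq_zero {t j n : ℕ} (h : n < j) : oddCoeff t j n = 0 := by
  simp [oddCoeff, Nat.choose_eq_zero_of_lt h]

/-- Exchanges the sums over `l ≤ n ≤ N`; the vanishing of `a` below `j` gives the range used in
`nestedSum`. -/
lemma sum_mul_sum_Ico_eq {N j : ℕ} (a : ℕ → ℕ) (β : ℕ → ℕ → ℕ) (g : ℕ → ℝ)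
    (ha : ∀ l < j, a l = 0) :
    ∑ l ∈ Finset.range (N + 1), (a l : ℝ) * ∑ n ∈ Finset.Ico l (N + 1), (β l n : ℝ) * g n =
      ∑ n ∈ Finset.range (N + 1), ((∑ l ∈ Finset.Icc j n, a l * β l n : ℕ) : ℝ) * g n := by
  have h : ∀ n, ((∑ l ∈ Finset.Icc j n, a l * β l n : ℕ) : ℝ) =
      ∑ l ∈ Finset.range (n + 1), (a l : ℝ) * β l n := by
    intro n
    push_cast
    refine Finset.sum_subset (fun l hl => ?_) fun l hl hl' => ?_
    · simp only [Finset.mem_Icc, Finset.mem_range] at *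
      omega
    · simp only [Finset.mem_Icc, Finset.mem_range] at *
      simp [ha l (by omega)]
  simp only [h, Finset.mul_sum, Finset.sum_mul]
  rw [Finset.sum_comm' (s' := fun n => Finset.range (n + 1)) (t' := Finset.range (N + 1))]
  · simp only [mul_assoc]
  · intro l n
    simp only [Finset.mem_Ico, Finset.mem_range]
    omega

lemma legendreKernel_pow_odd (N j t : ℕ) :
    legendreKernel N j ^ (2 * t + 3) =
      ∑ n ∈ Finset.range (N + 1), (oddCoeff t j n : ℝ) * legendreKernel N n := by
  induction t with
  | zero =>
    rw [show legendreKernel N j ^ (2 * 0 + 3) =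
      legendreKernel N j * legendreKernel N j * legendreKernel N j by ring,
      legendreKernel_mul_mul]
    have hs : Finset.Ico j (N + 1) ⊆ Finset.range (N + 1) := by
      intro n
      simp only [Finset.mem_Ico, Finset.mem_range]
      omega
    refine Eq.trans (Finset.sum_congr rfl fun n _ => ?_) (Finset.sum_subset hs fun n hn hn' => ?_)
    · simp only [oddCoeff, nestedSum, ← two_mul]
      push_cast
      ring
    · simp only [Finset.mem_Ico, Finset.mem_range] at hn hn'
      simp [oddCoeff_eq_zero (show n < j by omega)]
  | succ t ih =>
    rw [show legendreKernel N j ^ (2 * (t + 1) + 3) =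
      legendreKernel N j ^ (2 * t + 3) * (legendreKernel N j * legendreKernel N j) by ring,
      ih, Finset.sum_mul]
    simp only [mul_assoc, mul_comm (legendreKernel N _) (legendreKernel N j * legendreKernel N j)]
    simp only [← mul_assoc (legendreKernel N j), legendreKernel_mul_mul]
    rw [sum_mul_sum_Ico_eq (j := j) _ _ _ fun l hl => oddCoeff_eq_zero hl]
    refine Finset.sum_congr rfl fun n _ => ?_
    congr 2
    simp only [oddCoeff, nestedSum, Finset.mul_sum]
    refine Finset.sum_congr rfl fun l hl => ?_
    -- Squared, this identity supplies the new factor `C(2j,j)²` and the `C(l+j,l-j)²` of the next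
    -- level.
    have h := choose_mul_choose_add (Finset.mem_Icc.1 hl).1
    rw [← two_mul]
    calc _ = (2 * j).choose j ^ (2 * t + 2) * n.choose j ^ 2 * (2 * j).choose (n - l) *
          nestedSum j t l * (l.choose j * (l + j).choose j) ^ 2 := by ring
      _ = _ := by rw [← h]; ring

lemma legendreKernel_mul (N j l : ℕ) :
    legendreKernel N j * legendreKernel N l =
      ∑ n ∈ Finset.Ico l (N + 1), (((l + j).choose j * n.choose j * j.choose (n - l) : ℕ) : ℝ) *
        legendreKernel N n := by
  simpa [legendreKernel_zero] using legendreKernel_mul_mul N 0 j l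

lemma legendreKernel_pow_even (N j t : ℕ) :
    legendreKernel N j ^ (2 * t + 4) =
      ∑ n ∈ Finset.range (N + 1), (evenCoeff t j n : ℝ) * legendreKernel N n := by
  rw [show 2 * t + 4 = 2 * t + 3 + 1 by ring, pow_succ, legendreKernel_pow_odd, Finset.sum_mul]
  simp only [mul_assoc, mul_comm (legendreKernel N _) (legendreKernel N j)]
  simp only [legendreKernel_mul]
  rw [sum_mul_sum_Ico_eq (j := j) _ _ _ fun l hl => oddCoeff_eq_zero hl]
  refine Finset.sum_congr rfl fun n _ => ?_
  congr 2
  simp only [oddCoeff, evenCoeff, Finset.mul_sum]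
  refine Finset.sum_congr rfl fun l hl => ?_
  have h := choose_mul_choose_add (Finset.mem_Icc.1 hl).1
  calc _ = (2 * j).choose j ^ (2 * t + 2) * n.choose j * j.choose (n - l) * l.choose j *
        nestedSum j t l * (l.choose j * (l + j).choose j) := by ring
    _ = _ := by rw [← h]; ring

lemma legendreKernel_sq (N j : ℕ) :
    legendreKernel N j ^ 2 =
      ∑ n ∈ Finset.range (N + 1), ((n.choose j ^ 2 * (2 * j).choose n : ℕ) : ℝ) *
        legendreKernel N n := by
  rw [sq, legendreKernel_mul]
  have hs : Finset.Ico j (N + 1) ⊆ Finset.range (N + 1) := by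
    intro n
    simp only [Finset.mem_Ico, Finset.mem_range]
    omega
  refine Eq.trans (Finset.sum_congr rfl fun n hn => ?_) (Finset.sum_subset hs fun n hn hn' => ?_)
  · congr 2
    have h := Nat.choose_mul (n := 2 * j) (k := n) (s := j) (Finset.mem_Ico.1 hn).1
    rw [show 2 * j - j = j by omega] at h
    rw [← two_mul]
    calc _ = n.choose j * ((2 * j).choose j * j.choose (n - j)) := by ring
      _ = _ := by rw [← h]; ring
  · simp only [Finset.mem_Ico, Finset.mem_range] at hn hn'
    simp [Nat.choose_eq_zero_of_lt (show n < j by omega)]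

/-! ### Summation over `j`, uniqueness and the final formulas. -/

lemma isSchmidtSequence_of_pow_eq {r : ℕ} (b : ℕ → ℕ → ℕ) (hb : ∀ j n, n < j → b j n = 0)
    (h : ∀ N j, legendreKernel N j ^ r =
      ∑ n ∈ Finset.range (N + 1), (b j n : ℝ) * legendreKernel N n) :
    IsSchmidtSequence r fun n => ((∑ j ∈ Finset.range (n + 1), b j n : ℕ) : ℝ) := by
  intro N
  simp only [← mul_pow]
  change ∑ j ∈ Finset.range (N + 1), legendreKernel N j ^ r =
    ∑ n ∈ Finset.range (N + 1), legendreKernel N n * _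
  simp only [h]
  rw [Finset.sum_comm]
  refine Finset.sum_congr rfl fun n hn => ?_
  rw [← Finset.sum_mul, mul_comm]
  congr 1
  push_cast
  symm
  refine Finset.sum_subset (fun j hj => ?_) fun j _ hj => ?_
  · simp only [Finset.mem_range] at *
    omega
  · simp only [Finset.mem_range] at *
    simp [hb j n (by omega)]

lemma IsSchmidtSequence.unique {r : ℕ} {c d : ℕ → ℝ} (hc : IsSchmidtSequence r c)
    (hd : IsSchmidtSequence r d) : c = d := by
  funext n
  induction n using Nat.strong_induction_on with
  | _ n ih =>
    have h := (hc n).symm.trans (hd n)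
    rw [Finset.sum_range_succ, Finset.sum_range_succ,
      Finset.sum_congr rfl fun k hk => by rw [ih k (Finset.mem_range.1 hk)]] at h
    -- The equation at `n` has diagonal coefficient `C(2n,n)`, so it determines the term of index
    -- `n` from the earlier ones.
    have hpos : ((n.choose n : ℝ) * ((n + n).choose n : ℝ)) ≠ 0 := by
      have := Nat.choose_pos (Nat.le_add_left n n)
      rw [Nat.choose_self]
      positivity
    exact mul_left_cancel₀ hpos (add_left_cancel h)

lemma isSchmidtSequence_odd (t : ℕ) : IsSchmidtSequence (2 * t + 3)
    fun n => ((∑ j ∈ Finset.range (n + 1), oddCoeff t j n : ℕ) : ℝ) :=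
  isSchmidtSequence_of_pow_eq _ (fun _ _ h => oddCoeff_eq_zero h)
    fun N j => legendreKernel_pow_odd N j t

lemma isSchmidtSequence_even (t : ℕ) : IsSchmidtSequence (2 * t + 4)
    fun n => ((∑ j ∈ Finset.range (n + 1), evenCoeff t j n : ℕ) : ℝ) :=
  isSchmidtSequence_of_pow_eq _ (fun j n h => by simp [evenCoeff, Nat.choose_eq_zero_of_lt h])
    fun N j => legendreKernel_pow_even N j t

lemma isSchmidtSequence_two : IsSchmidtSequence 2
    fun n => ((∑ j ∈ Finset.range (n + 1), n.choose j ^ 2 * (2 * j).choose n : ℕ) : ℝ) :=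
  isSchmidtSequence_of_pow_eq _ (fun j n h => by simp [Nat.choose_eq_zero_of_lt h])
    legendreKernel_sq

lemma exists_nat_isSchmidtSequence {r : ℕ} (hr : 2 ≤ r) :
    ∃ f : ℕ → ℕ, IsSchmidtSequence r fun n => (f n : ℝ) := by
  obtain rfl | ⟨t, rfl⟩ | ⟨t, rfl⟩ :
      r = 2 ∨ (∃ t, r = 2 * t + 3) ∨ ∃ t, r = 2 * t + 4 := by
    rcases Nat.even_or_odd' r with ⟨t, rfl | rfl⟩
    · rcases eq_or_ne t 1 with rfl | h
      · exact Or.inl rfl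
      · exact Or.inr (Or.inr ⟨t - 2, by omega⟩)
    · exact Or.inr (Or.inl ⟨t - 1, by omega⟩)
  · exact ⟨_, isSchmidtSequence_two⟩
  · exact ⟨_, isSchmidtSequence_odd t⟩
  · exact ⟨_, isSchmidtSequence_even t⟩

theorem theorem1 :
    -- the defining relation determines the sequence, and its terms are integers
    (∀ r : ℕ, 2 ≤ r →
      (∃! c : ℕ → ℝ, IsSchmidtSequence r c) ∧
      ∀ c : ℕ → ℝ, IsSchmidtSequence r c → ∀ k : ℕ, ∃ z : ℤ, c k = (z : ℝ)) ∧
    -- r = 4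
    (∀ c : ℕ → ℝ, IsSchmidtSequence 4 c → ∀ n : ℕ,
      c n = ((∑ j ∈ Finset.range (n + 1), (2 * j).choose j ^ 3 * n.choose j *
        ∑ k ∈ Finset.Icc j n, (k + j).choose (k - j) * j.choose (n - k) * k.choose j *
          (2 * j).choose (k - j) : ℕ) : ℝ)) ∧
    -- r = 5
    (∀ c : ℕ → ℝ, IsSchmidtSequence 5 c → ∀ n : ℕ,
      c n = ((∑ j ∈ Finset.range (n + 1), (2 * j).choose j ^ 4 * n.choose j ^ 2 *
        ∑ k ∈ Finset.Icc j n, (k + j).choose (k - j) ^ 2 * (2 * j).choose (n - k) *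
          (2 * j).choose (k - j) : ℕ) : ℝ)) ∧
    -- r = 2 s with s = 1
    (∀ c : ℕ → ℝ, IsSchmidtSequence 2 c → ∀ n : ℕ,
      c n = ((∑ j ∈ Finset.range (n + 1), n.choose j ^ 2 * (2 * j).choose n : ℕ) : ℝ)) ∧
    -- r = 2 s with s ≥ 2
    (∀ s : ℕ, 2 ≤ s → ∀ c : ℕ → ℝ, IsSchmidtSequence (2 * s) c → ∀ n : ℕ,
      c n = ((∑ j ∈ Finset.range (n + 1), (2 * j).choose j ^ (2 * s - 1) * n.choose j *
        ∑ k ∈ Finset.Icc j n, j.choose (n - k) * k.choose j * (k + j).choose (k - j) *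
          nestedSum j (s - 2) k : ℕ) : ℝ)) ∧
    -- r = 2 s + 1 with s ≥ 1
    (∀ s : ℕ, 1 ≤ s → ∀ c : ℕ → ℝ, IsSchmidtSequence (2 * s + 1) c → ∀ n : ℕ,
      c n = ((∑ j ∈ Finset.range (n + 1), (2 * j).choose j ^ (2 * s) * n.choose j ^ 2 *
        nestedSum j (s - 1) n : ℕ) : ℝ)) := by
  refine ⟨fun r hr => ?_, fun c hc n => ?_, fun c hc n => ?_, fun c hc n => ?_,
    fun s hs c hc n => ?_, fun s hs c hc n => ?_⟩
  · obtain ⟨f, hf⟩ := exists_nat_isSchmidtSequence hr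
    refine ⟨⟨_, hf, fun d hd => hd.unique hf⟩, fun c hc k => ⟨f k, ?_⟩⟩
    rw [hc.unique hf]
    simp
  · rw [hc.unique (isSchmidtSequence_even 0), Nat.cast_inj]
    refine Finset.sum_congr rfl fun j _ => ?_
    simp only [evenCoeff, nestedSum, mul_zero, zero_add]
    refine congrArg (_ * ·) (Finset.sum_congr rfl fun k _ => ?_)
    ring
  · rw [hc.unique (isSchmidtSequence_odd 1), Nat.cast_inj]
    refine Finset.sum_congr rfl fun j _ => ?_
    simp only [oddCoeff, nestedSum, mul_one, Nat.reduceAdd]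
    refine congrArg (_ * ·) (Finset.sum_congr rfl fun k _ => ?_)
    ring
  · rw [hc.unique isSchmidtSequence_two]
  · obtain ⟨t, rfl⟩ := Nat.exists_eq_add_of_le' hs
    rw [show 2 * (t + 2) = 2 * t + 4 by ring] at hc
    rw [hc.unique (isSchmidtSequence_even t)]
    simp only [evenCoeff, show 2 * (t + 2) - 1 = 2 * t + 3 by omega, Nat.add_sub_cancel]
  · obtain ⟨t, rfl⟩ := Nat.exists_eq_add_of_le' hs
    rw [show 2 * (t + 1) + 1 = 2 * t + 3 by ring] at hc
    rw [hc.unique (isSchmidtSequence_odd t)]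
    simp only [oddCoeff, show 2 * (t + 1) = 2 * t + 2 by ring, Nat.add_sub_cancel]
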